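/- Fix a set $P$ of proposition letters. Given (possibly empty) index sets $D,B$, consider the formulas built from $P$ with $\bot,\top,\wedge,\vee$ and the unary connectives $\neg$, $\Diamond_d,\blacksquare_d$ ($d\in D$), $\Box_b,\blacklozenge_b$ ($b\in B$). Given $I\subseteq D\times B$, let $\mathbf{L}(D,B,I)$ be the least set of sequents $\varphi\vdash\psi$ that * contains all instances of $\varphi\vdash\varphi$, $\bot\vdash\varphi$, $\varphi\vdash\top$, $\varphi\vdash\varphi\vee\psi$, $\psi\vdash\varphi\vee\psi$, $\varphi\wedge\psi\vdash\varphi$, $\varphi\wedge\psi\vdash\psi$, and is closed under: from $\varphi\vdash\chi$ and $\chi\vdash\psi$ infer $\varphi\vdash\psi$; from $\chi\vdash\varphi$ and $\chi\vdash\psi$ infer $\chi\vdash\varphi\wedge\psi$; from $\varphi\vdash\chi$ and $\psi\vdash\chi$ infer $\varphi\vee\psi\vdash\chi$; * contains $f\bot\vdash\bot$ and $f(\varphi\vee\psi)\vdash f\varphi\vee f\psi$ for each $f\in\{\Diamond_d,\blacklozenge_b\}$, contains $\top\vdash g\top$ and $g\varphi\wedge g\psi\vdash g(\varphi\wedge\psi)$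 for each $g\in\{\Box_b,\blacksquare_d\}$, contains $\top\vdash\neg\bot$ and $\neg\varphi\wedge\neg\psi\vdash\neg(\varphi\vee\psi)$, and is closed under monotonicity of $\Diamond_d,\blacklozenge_b,\Box_b,\blacksquare_d$ and antitonicity of $\neg$; * is closed in both directions under the residuation rules: $\Diamond_d\varphi\vdash\psi$ iff $\varphi\vdash\blacksquare_d\psi$, and $\blacklozenge_b\varphi\vdash\psi$ iff $\varphi\vdash\Box_b\psi$; * contains $\varphi\wedge\neg\varphi\vdash\bot$, is closed under: from $\varphi\vdash\neg\psi$ infer $\psi\vdash\neg\varphi$, and contains $\Diamond_d\neg\varphi\vdash\neg\Box_b\varphi$ for each $(d,b)\in I$. *Fundamental logic* is the case $D=B=I=\varnothing$. *Tense fundamental modal logic* is the case where $D$ and $B$ are one-element sets and $I=D\times B$ (one $\Diamond$, one $\Box$, their residuals $\blacksquare,\blacklozenge$, and the axiom $\Diamond\neg\varphi\vdash\neg\Box\varphi$). Let $\mathrm{Var}^{+}(\varphi)$ and $\mathrm{Var}^{-}(\varphi)$ be the sets of letters with a positive, respectively negative, occurrence in $\varphi$ (an occurrence is positive if it lies in the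 scope of an even number of $\neg$, and negative otherwise). A logic $\mathbf{L}$ has the *Lyndon interpolation property* if whenever $\varphi\vdash\psi$ belongs to $\mathbf{L}$, there is a formula $\gamma$ of the same language such that $\varphi\vdash\gamma$ and $\gamma\vdash\psi$ belong to $\mathbf{L}$, $\mathrm{Var}^{+}(\gamma)\subseteq\mathrm{Var}^{+}(\varphi)\cap\mathrm{Var}^{+}(\psi)$ and $\mathrm{Var}^{-}(\gamma)\subseteq\mathrm{Var}^{-}(\varphi)\cap\mathrm{Var}^{-}(\psi)$. **Corollary.** Fundamental logic, tense fundamental modal logic, and more generally all the modal expansions with tense connectives $\mathbf{L}(D,B,I)$ of fundamental logic, have the Lyndon interpolation property. -/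

import Mathlib

namespace FundLogic

/-- Formulas over the proposition letters `P`, in the language with the lattice connectives,
negation `¬`, and for each `d : D` an adjoint pair `◇_d ⊣ ■_d` and for each `b : B` an adjoint pair
`◆_b ⊣ □_b`. The connectives `◇_d`, `◆_b` are the members of `𝓕`, and `¬`, `□_b`, `■_d` those of
`𝓖`; all are unary and monotone except `¬`, which is antitone. -/
inductive Formula (P D B : Type*) where
  | atom (p : P)
  | bot
  | top
  | and (φ ψ : Formula P D B)
  | or (φ ψ : Formula P D B)
  | neg (φ : Formula P D B)
  | dia (d : D) (φ : Formula P D B)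
  | bbox (d : D) (φ : Formula P D B)
  | box (b : B) (φ : Formula P D B)
  | bdia (b : B) (φ : Formula P D B)

namespace Formula

variable {P D B : Type*}

/-- `φ.varsPol true` (resp. `φ.varsPol false`) is the set of the proposition letters that have a
positive (resp. negative) occurrence in `φ`. -/
def varsPol : Bool → Formula P D B → Set P
  | true, atom p => {p}
  | false, atom _ => ∅
  | _, bot => ∅
  | _, top => ∅
  | s, and φ ψ => varsPol s φ ∪ varsPol s ψ
  | s, or φ ψ => varsPol s φ ∪ varsPol s ψ
  | s, neg φ => varsPol (!s) φ
  | s, dia _ φ => varsPol s φ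
  | s, bbox _ φ => varsPol s φ
  | s, box _ φ => varsPol s φ
  | s, bdia _ φ => varsPol s φ

/-- The proposition letters that occur positively. -/
def posVars (φ : Formula P D B) : Set P := φ.varsPol true

/-- The proposition letters that occur negatively. -/
def negVars (φ : Formula P D B) : Set P := φ.varsPol false

/-- Uniform substitution. -/
def subst (σ : P → Formula P D B) : Formula P D B → Formula P D B
  | atom p => σ p
  | bot => bot
  | top => top
  | and φ ψ => and (subst σ φ) (subst σ ψ)
  | or φ ψ => or (subst σ φ) (subst σ ψ)
  | neg φ => neg (subst σ φ)
  | dia d φ => dia d (subst σ φ)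
  | bbox d φ => bbox d (subst σ φ)
  | box b φ => box b (subst σ φ)
  | bdia b φ => bdia b (subst σ φ)

end Formula

open Formula in
/-- `Derives I φ ψ`: the sequent `φ ⊢ ψ` belongs to the tense expansion of fundamental logic with
the interaction axioms `◇_d ¬ φ ⊢ ¬ □_b φ` for the pairs with `I d b`. The axioms are schemes, so
that the set of derivable sequents is closed under uniform substitution (`Derives.subst`). -/
inductive Derives {P D B : Type*} (I : D → B → Prop) :
    Formula P D B → Formula P D B → Prop where
  -- bounded lattices
  | refl (φ) : Derives I φ φ
  | bot_left (φ) : Derives I bot φ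
  | top_right (φ) : Derives I φ top
  | or_inl (φ ψ) : Derives I φ (or φ ψ)
  | or_inr (φ ψ) : Derives I ψ (or φ ψ)
  | and_fst (φ ψ) : Derives I (and φ ψ) φ
  | and_snd (φ ψ) : Derives I (and φ ψ) ψ
  | cut {φ χ ψ} : Derives I φ χ → Derives I χ ψ → Derives I φ ψ
  | and_intro {χ φ ψ} : Derives I χ φ → Derives I χ ψ → Derives I χ (and φ ψ)
  | or_elim {φ ψ χ} : Derives I φ χ → Derives I ψ χ → Derives I (or φ ψ) χ
  -- normality of the members of `𝓕`
  | dia_bot (d) : Derives I (dia d bot) bot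
  | dia_or (d φ ψ) : Derives I (dia d (or φ ψ)) (or (dia d φ) (dia d ψ))
  | bdia_bot (b) : Derives I (bdia b bot) bot
  | bdia_or (b φ ψ) : Derives I (bdia b (or φ ψ)) (or (bdia b φ) (bdia b ψ))
  -- normality of the members of `𝓖`
  | box_top (b) : Derives I top (box b top)
  | box_and (b φ ψ) : Derives I (and (box b φ) (box b ψ)) (box b (and φ ψ))
  | bbox_top (d) : Derives I top (bbox d top)
  | bbox_and (d φ ψ) : Derives I (and (bbox d φ) (bbox d ψ)) (bbox d (and φ ψ))
  | neg_bot : Derives I top (neg bot)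
  | neg_or (φ ψ) : Derives I (and (neg φ) (neg ψ)) (neg (or φ ψ))
  -- monotonicity and antitonicity
  | dia_mono (d) {φ ψ} : Derives I φ ψ → Derives I (dia d φ) (dia d ψ)
  | bdia_mono (b) {φ ψ} : Derives I φ ψ → Derives I (bdia b φ) (bdia b ψ)
  | box_mono (b) {φ ψ} : Derives I φ ψ → Derives I (box b φ) (box b ψ)
  | bbox_mono (d) {φ ψ} : Derives I φ ψ → Derives I (bbox d φ) (bbox d ψ)
  | neg_anti {φ ψ} : Derives I φ ψ → Derives I (neg ψ) (neg φ)
  -- residuation for the tense connectives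
  | dia_adj (d) {φ ψ} : Derives I (dia d φ) ψ → Derives I φ (bbox d ψ)
  | dia_adj_inv (d) {φ ψ} : Derives I φ (bbox d ψ) → Derives I (dia d φ) ψ
  | box_adj (b) {φ ψ} : Derives I φ (box b ψ) → Derives I (bdia b φ) ψ
  | box_adj_inv (b) {φ ψ} : Derives I (bdia b φ) ψ → Derives I φ (box b ψ)
  -- the postulates of fundamental (modal) logic
  | neg_contra (φ) : Derives I (and φ (neg φ)) bot
  | neg_galois {φ ψ} : Derives I φ (neg ψ) → Derives I ψ (neg φ)
  | inter {d b} (φ) : I d b → Derives I (dia d (neg φ)) (neg (box b φ))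

theorem Derives.subst {P D B : Type*} {I : D → B → Prop} {φ ψ : Formula P D B}
    (h : Derives I φ ψ) (σ : P → Formula P D B) : Derives I (φ.subst σ) (ψ.subst σ) := by
  induction h with
  | refl => exact .refl _
  | bot_left => exact .bot_left _
  | top_right => exact .top_right _
  | or_inl => exact .or_inl _ _
  | or_inr => exact .or_inr _ _
  | and_fst => exact .and_fst _ _
  | and_snd => exact .and_snd _ _
  | cut _ _ h1 h2 => exact .cut h1 h2
  | and_intro _ _ h1 h2 => exact .and_intro h1 h2
  | or_elim _ _ h1 h2 => exact .or_elim h1 h2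
  | dia_bot => exact .dia_bot _
  | dia_or => exact .dia_or _ _ _
  | bdia_bot => exact .bdia_bot _
  | bdia_or => exact .bdia_or _ _ _
  | box_top => exact .box_top _
  | box_and => exact .box_and _ _ _
  | bbox_top => exact .bbox_top _
  | bbox_and => exact .bbox_and _ _ _
  | neg_bot => exact .neg_bot
  | neg_or => exact .neg_or _ _
  | dia_mono _ _ h => exact .dia_mono _ h
  | bdia_mono _ _ h => exact .bdia_mono _ h
  | box_mono _ _ h => exact .box_mono _ h
  | bbox_mono _ _ h => exact .bbox_mono _ h
  | neg_anti _ h => exact .neg_anti h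
  | dia_adj _ _ h => exact .dia_adj _ h
  | dia_adj_inv _ _ h => exact .dia_adj_inv _ h
  | box_adj _ _ h => exact .box_adj _ h
  | box_adj_inv _ _ h => exact .box_adj_inv _ h
  | neg_contra => exact .neg_contra _
  | neg_galois _ h => exact .neg_galois h
  | inter _ hI => exact .inter _ hI

/-- Fundamental logic: there are no modal connectives, the only connectives being
`∧`, `∨`, `⊤`, `⊥` and `¬`. -/
def FundamentalLogic (P : Type*) : Formula P Empty Empty → Formula P Empty Empty → Prop :=
  Derives (fun _ _ => False)

/-- Tense fundamental modal logic: one `◇` with its residual `■`, one `□` with its residual `◆`,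
and the axiom `◇ ¬ φ ⊢ ¬ □ φ`. -/
def TenseFundamentalModalLogic (P : Type*) : Formula P Unit Unit → Formula P Unit Unit → Prop :=
  Derives (fun _ _ => True)

/-- The Lyndon interpolation property of a set `L` of sequents. -/
def LyndonInterpolation {P D B : Type*} (L : Formula P D B → Formula P D B → Prop) : Prop :=
  ∀ φ ψ : Formula P D B, L φ ψ → ∃ γ : Formula P D B, L φ γ ∧ L γ ψ ∧
    γ.posVars ⊆ φ.posVars ∩ ψ.posVars ∧ γ.negVars ⊆ φ.negVars ∩ ψ.negVars

end FundLogic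

/-! Interpolants can be read off derivations without cut, so the derivations of `Derives` are
replaced by those of `CutFree`. There an antecedent is one formula under a word of left adjoints,
and a succedent is a formula or the negation of another such pair. In the negated case the two sides
play symmetric roles (`perp_symm`), and the interaction axiom becomes a rule trading `◆_b` at the
head of the antecedent for `◇_d` on the other side.

`CutFree.interpolable` builds interpolants by induction: most rules keep the interpolant of a
premise or combine those of two, and `perp_symm` negates it, swapping polarities.

Completeness of the calculus, `Derives.cutFree`, is proved semantically. Formulas denote sets of
antecedents closed for the polarity given by cut-free provability. `Derives.interp_subset` is
soundness, cut being transitivity of inclusion. By `mem_interp_and_subset` (Okada's lemma), `([],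
φ)` lies in `interp I φ ⊆ interp I ψ`, all of whose members prove `ψ` without cut. -/

namespace FundLogic

/-! ### Words of left adjoints. -/

namespace Formula

variable {P D B : Type*}

/-- The left adjoints `◇_d`, `◆_b`, indexed by `D ⊕ B`. -/
def lower : D ⊕ B → Formula P D B → Formula P D B
  | .inl d, φ => dia d φ
  | .inr b, φ => bdia b φ

/-- The right adjoints `■_d`, `□_b` of the connectives `Formula.lower`. -/
def upper : D ⊕ B → Formula P D B → Formula P D B
  | .inl d, φ => bbox d φ
  | .inr b, φ => box b φ

/-- A word of left adjoints, applied to a formula, the head of the word being outermost. -/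
def lowers (w : List (D ⊕ B)) (φ : Formula P D B) : Formula P D B :=
  w.foldr lower φ

@[simp] theorem lowers_nil (φ : Formula P D B) : lowers [] φ = φ := rfl

@[simp] theorem lowers_cons (o : D ⊕ B) (w : List (D ⊕ B)) (φ : Formula P D B) :
    lowers (o :: w) φ = lower o (lowers w φ) := rfl

@[simp] theorem lowers_append (v w : List (D ⊕ B)) (φ : Formula P D B) :
    lowers (v ++ w) φ = lowers v (lowers w φ) := by
  simp [lowers]

section VarsPol

variable (s : Bool) (φ ψ : Formula P D B)

@[simp] theorem varsPol_bot : (bot : Formula P D B).varsPol s = ∅ := by cases s <;> rfl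

@[simp] theorem varsPol_top : (top : Formula P D B).varsPol s = ∅ := by cases s <;> rfl

@[simp] theorem varsPol_and : (and φ ψ).varsPol s = φ.varsPol s ∪ ψ.varsPol s := by
  cases s <;> rfl

@[simp] theorem varsPol_or : (or φ ψ).varsPol s = φ.varsPol s ∪ ψ.varsPol s := by
  cases s <;> rfl

@[simp] theorem varsPol_neg : (neg φ).varsPol s = φ.varsPol (!s) := by cases s <;> rfl

@[simp] theorem varsPol_lower (o : D ⊕ B) : (lower o φ).varsPol s = φ.varsPol s := by
  cases o <;> cases s <;> rfl

@[simp] theorem varsPol_upper (o : D ⊕ B) : (upper o φ).varsPol s = φ.varsPol s := by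
  cases o <;> cases s <;> rfl

@[simp] theorem varsPol_lowers (w : List (D ⊕ B)) : (lowers w φ).varsPol s = φ.varsPol s := by
  induction w with
  | nil => rfl
  | cons o w ih => simp [ih]

end VarsPol

end Formula

open Formula

variable {P D B : Type*} {I : D → B → Prop}

/-! ### Derived rules for the Hilbert-style system. -/

namespace Derives

theorem lower_mono (o : D ⊕ B) {φ ψ : Formula P D B} (h : Derives I φ ψ) :
    Derives I (lower o φ) (lower o ψ) := by
  cases o with
  | inl d => exact .dia_mono d h
  | inr b => exact .bdia_mono b h

theorem upper_mono (o : D ⊕ B) {φ ψ : Formula P D B} (h : Derives I φ ψ) :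
    Derives I (upper o φ) (upper o ψ) := by
  cases o with
  | inl d => exact .bbox_mono d h
  | inr b => exact .box_mono b h

theorem to_upper (o : D ⊕ B) {φ ψ : Formula P D B} (h : Derives I (lower o φ) ψ) :
    Derives I φ (upper o ψ) := by
  cases o with
  | inl d => exact .dia_adj d h
  | inr b => exact .box_adj_inv b h

theorem of_upper (o : D ⊕ B) {φ ψ : Formula P D B} (h : Derives I φ (upper o ψ)) :
    Derives I (lower o φ) ψ := by
  cases o with
  | inl d => exact .dia_adj_inv d h
  | inr b => exact .box_adj b h

theorem lowers_mono (w : List (D ⊕ B)) {φ ψ : Formula P D B} (h : Derives I φ ψ) :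
    Derives I (lowers w φ) (lowers w ψ) := by
  induction w with
  | nil => exact h
  | cons o w ih => exact ih.lower_mono o

theorem lowers_bot (w : List (D ⊕ B)) : Derives (P := P) I (lowers w bot) bot := by
  induction w with
  | nil => exact .refl _
  | cons o w ih => exact .of_upper o (ih.cut (.bot_left _))

/-- Residuation moves the word to the right letter by letter, which changes `χ` and leaves a plain
`or_elim`. -/
theorem lowers_or (w : List (D ⊕ B)) {φ ψ χ : Formula P D B}
    (h₁ : Derives I (lowers w φ) χ) (h₂ : Derives I (lowers w ψ) χ) :
    Derives I (lowers w (or φ ψ)) χ := by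
  induction w generalizing χ with
  | nil => exact .or_elim h₁ h₂
  | cons o w ih => exact .of_upper o (ih (h₁.to_upper o) (h₂.to_upper o))

theorem neg_neg (φ : Formula P D B) : Derives I φ (neg (neg φ)) := .neg_galois (.refl _)

theorem bot_of_neg_self {φ : Formula P D B} (h : Derives I φ (neg φ)) : Derives I φ bot :=
  .cut (.and_intro (.refl _) h) (.neg_contra _)

end Derives

/-! ### The cut-free calculus. -/

/-- The right-hand side of a cut-free sequent: a formula, or the negation of a word of left
adjoints applied to a formula. -/
inductive Succedent (P D B : Type*) where
  | form (ψ : Formula P D B)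
  | perp (v : List (D ⊕ B)) (ψ : Formula P D B)

/-- The formula denoted by a succedent. -/
def Succedent.toFormula : Succedent P D B → Formula P D B
  | form ψ => ψ
  | perp v ψ => neg (lowers v ψ)

open Succedent in
/-- The cut-free calculus. The sequent `CutFree I w φ r` says that the word `w` of left adjoints,
applied to `φ`, entails the succedent `r`. -/
inductive CutFree (I : D → B → Prop) :
    List (D ⊕ B) → Formula P D B → Succedent P D B → Prop where
  | atom (p : P) : CutFree I [] (atom p) (form (atom p))
  | bot_left (w r) : CutFree I w bot r
  | top_right (w φ) : CutFree I w φ (form top)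
  | and_left_fst {w φ r} (ψ) : CutFree I w φ r → CutFree I w (and φ ψ) r
  | and_left_snd {w ψ r} (φ) : CutFree I w ψ r → CutFree I w (and φ ψ) r
  | and_right {w χ φ ψ} : CutFree I w χ (form φ) → CutFree I w χ (form ψ) →
      CutFree I w χ (form (and φ ψ))
  | or_left {w φ ψ r} : CutFree I w φ r → CutFree I w ψ r → CutFree I w (or φ ψ) r
  | or_right_inl {w χ φ} (ψ) : CutFree I w χ (form φ) → CutFree I w χ (form (or φ ψ))
  | or_right_inr {w χ ψ} (φ) : CutFree I w χ (form ψ) → CutFree I w χ (form (or φ ψ))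
  | lower_left {w o φ r} : CutFree I (w ++ [o]) φ r → CutFree I w (lower o φ) r
  | lower_right {w χ φ} (o) : CutFree I w χ (form φ) → CutFree I (o :: w) χ (form (lower o φ))
  | upper_left {w φ r} (o) : CutFree I w φ r → CutFree I (w ++ [o]) (upper o φ) r
  | upper_right {o w χ φ} : CutFree I (o :: w) χ (form φ) → CutFree I w χ (form (upper o φ))
  | neg_left {w χ φ} : CutFree I w χ (form φ) → CutFree I w χ (perp [] (neg φ))
  | neg_right {w χ φ} : CutFree I w χ (perp [] φ) → CutFree I w χ (form (neg φ))
  | perp_symm {w φ v ψ} : CutFree I w φ (perp v ψ) → CutFree I v ψ (perp w φ)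
  | contract {w φ} (v r) : CutFree I w φ (perp w φ) → CutFree I (v ++ w) φ r
  | inter {d b w φ v ψ} : I d b → CutFree I (.inr b :: w) φ (perp v ψ) →
      CutFree I w φ (perp (.inl d :: v) ψ)

/-! ### Interpolants from cut-free derivations. -/

section Interpolation

/-- The sequent `φ ⊢ ψ` has a Lyndon interpolant. -/
def Interpolable (I : D → B → Prop) (φ ψ : Formula P D B) : Prop :=
  ∃ γ, Derives I φ γ ∧ Derives I γ ψ ∧ ∀ s, γ.varsPol s ⊆ φ.varsPol s ∩ ψ.varsPol s

theorem Interpolable.of_bot {φ ψ : Formula P D B} (h : Derives I φ bot) :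
    Interpolable I φ ψ :=
  ⟨bot, h, .bot_left _, by simp⟩

theorem Interpolable.mono {φ φ' ψ ψ' : Formula P D B} (h : Interpolable I φ ψ)
    (h₁ : Derives I φ' φ) (h₂ : Derives I ψ ψ')
    (v₁ : ∀ s, φ.varsPol s ⊆ φ'.varsPol s) (v₂ : ∀ s, ψ.varsPol s ⊆ ψ'.varsPol s) :
    Interpolable I φ' ψ' := by
  obtain ⟨γ, hl, hr, hv⟩ := h
  exact ⟨γ, h₁.cut hl, hr.cut h₂, fun s =>
    (hv s).trans (Set.inter_subset_inter (v₁ s) (v₂ s))⟩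

theorem CutFree.interpolable {w : List (D ⊕ B)} {φ : Formula P D B} {r : Succedent P D B}
    (h : CutFree I w φ r) : Interpolable I (lowers w φ) r.toFormula := by
  induction h with
  | atom p => exact ⟨.atom p, .refl _, .refl _, fun s => by simp [Succedent.toFormula]⟩
  | bot_left w r => exact .of_bot (.lowers_bot w)
  | top_right w φ => exact ⟨top, .top_right _, .refl _, by simp⟩
  | and_left_fst ψ _ ih =>
    exact ih.mono (.lowers_mono _ (.and_fst _ _)) (.refl _) (by simp) (by simp)
  | and_left_snd φ _ ih =>
    exact ih.mono (.lowers_mono _ (.and_snd _ _)) (.refl _) (by simp) (by simp)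
  | and_right _ _ ih₁ ih₂ =>
    obtain ⟨γ, hl, hr, hv⟩ := ih₁
    obtain ⟨δ, kl, kr, kv⟩ := ih₂
    refine ⟨and γ δ, .and_intro hl kl,
      .and_intro (.cut (.and_fst _ _) hr) (.cut (.and_snd _ _) kr), fun s => ?_⟩
    have := hv s
    have := kv s
    simp_all only [Succedent.toFormula, varsPol_lowers, varsPol_and]
    grind
  | or_left _ _ ih₁ ih₂ =>
    obtain ⟨γ, hl, hr, hv⟩ := ih₁
    obtain ⟨δ, kl, kr, kv⟩ := ih₂
    refine ⟨or γ δ, .lowers_or _ (hl.cut (.or_inl _ _)) (kl.cut (.or_inr _ _)),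
      .or_elim hr kr, fun s => ?_⟩
    have := hv s
    have := kv s
    simp_all only [varsPol_lowers, varsPol_or]
    grind
  | or_right_inl ψ _ ih =>
    exact ih.mono (.refl _) (.or_inl _ _) (by simp) (by simp [Succedent.toFormula])
  | or_right_inr φ _ ih =>
    exact ih.mono (.refl _) (.or_inr _ _) (by simp) (by simp [Succedent.toFormula])
  | lower_left _ ih => simpa using ih
  | lower_right o _ ih =>
    obtain ⟨γ, hl, hr, hv⟩ := ih
    exact ⟨lower o γ, hl.lower_mono o, hr.lower_mono o,
      by simpa [Succedent.toFormula] using hv⟩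
  | upper_left o _ ih =>
    refine ih.mono ?_ (.refl _) (by simp) (by simp)
    rw [lowers_append]
    exact .lowers_mono _ (.of_upper o (.refl _))
  | upper_right _ ih =>
    obtain ⟨γ, hl, hr, hv⟩ := ih
    exact ⟨upper _ γ, hl.to_upper _, hr.upper_mono _,
      by simpa [Succedent.toFormula] using hv⟩
  | neg_left _ ih =>
    exact ih.mono (.refl _) (.neg_neg _) (by simp) (by simp [Succedent.toFormula])
  | neg_right _ ih => exact ih
  | perp_symm _ ih =>
    obtain ⟨γ, hl, hr, hv⟩ := ih
    -- Exchanging the sides contraposes both halves; the letters of `neg γ` of sign `s` are those of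
    -- `γ` of sign `!s`.
    refine ⟨neg γ, .neg_galois hr, .neg_anti hl, fun s => ?_⟩
    have := hv !s
    simp_all [Succedent.toFormula]
  | contract v r _ ih =>
    -- The succedent `r` is arbitrary, so `γ` may have the wrong letters; but the antecedent entails
    -- its own negation, so `bot` interpolates.
    obtain ⟨γ, hl, hr, -⟩ := ih
    refine .of_bot ?_
    rw [lowers_append]
    exact (Derives.lowers_mono v (hl.cut hr).bot_of_neg_self).cut (.lowers_bot v)
  | @inter d b _ _ _ _ hI _ ih =>
    obtain ⟨γ, hl, hr, hv⟩ := ih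
    -- Residuation turns `◆_b` on the left into `□_b` on `γ`; the axiom `◇_d ¬γ ⊢ ¬□_b γ`,
    -- contraposed, gives the other half.
    exact ⟨box b γ, hl.to_upper (.inr b),
      .neg_galois (.cut (.dia_mono d (.neg_galois hr)) (.inter γ hI)),
      fun s => by simpa [Succedent.toFormula, show box b γ = upper (.inr b) γ from rfl] using hv s⟩

end Interpolation

/-! ### Completeness of the cut-free calculus by phase semantics. -/

section PhaseSemantics

/-- The closure of a set of antecedents in the polarity between antecedents `(u, φ)` and contexts
`(w, r)` given by `CutFree I (w ++ u) φ r`. -/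
def closure (I : D → B → Prop) (S : Set (List (D ⊕ B) × Formula P D B)) :
    Set (List (D ⊕ B) × Formula P D B) :=
  {x | ∀ w r, (∀ y ∈ S, CutFree I (w ++ y.1) y.2 r) → CutFree I (w ++ x.1) x.2 r}

theorem subset_closure (S : Set (List (D ⊕ B) × Formula P D B)) : S ⊆ closure I S :=
  fun x hx _ _ h => h x hx

/-- The sets of antecedents that are determined by contexts. -/
def IsClosedSet (I : D → B → Prop) (S : Set (List (D ⊕ B) × Formula P D B)) : Prop :=
  closure I S ⊆ S

theorem closure_subset {S T : Set (List (D ⊕ B) × Formula P D B)} (hT : IsClosedSet I T)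
    (h : S ⊆ T) : closure I S ⊆ T :=
  fun _ hx => hT fun w r hT' => hx w r fun y hy => hT' y (h hy)

theorem isClosedSet_closure (S : Set (List (D ⊕ B) × Formula P D B)) :
    IsClosedSet I (closure I S) :=
  fun _ hx w r h => hx w r fun _ hy => hy w r h

theorem isClosedSet_setOf (r : Succedent P D B) :
    IsClosedSet I {x | CutFree I x.1 x.2 r} :=
  fun _ hx => hx [] r fun _ hy => hy

theorem IsClosedSet.inter {S T : Set (List (D ⊕ B) × Formula P D B)} (hS : IsClosedSet I S)
    (hT : IsClosedSet I T) : IsClosedSet I (S ∩ T) :=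
  fun _ hx => ⟨closure_subset hS Set.inter_subset_left hx,
    closure_subset hT Set.inter_subset_right hx⟩

/-- The image of a set of antecedents under the left adjoint `o`. -/
def lowerSet (o : D ⊕ B) (S : Set (List (D ⊕ B) × Formula P D B)) :
    Set (List (D ⊕ B) × Formula P D B) :=
  (fun x => (o :: x.1, x.2)) '' S

/-- The preimage of a set of antecedents under the left adjoint `o`. -/
def upperSet (o : D ⊕ B) (S : Set (List (D ⊕ B) × Formula P D B)) :
    Set (List (D ⊕ B) × Formula P D B) :=
  {x | (o :: x.1, x.2) ∈ S}

/-- The antecedents that are incompatible with all members of a set. -/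
def perpSet (I : D → B → Prop) (S : Set (List (D ⊕ B) × Formula P D B)) :
    Set (List (D ⊕ B) × Formula P D B) :=
  {x | ∀ y ∈ S, CutFree I x.1 x.2 (.perp y.1 y.2)}

/-- This is why contexts carry a word `w`: the letter `o` is absorbed into it as `w ++ [o]`. -/
theorem IsClosedSet.upperSet {S : Set (List (D ⊕ B) × Formula P D B)} (hS : IsClosedSet I S)
    (o : D ⊕ B) : IsClosedSet I (upperSet o S) := fun x hx => hS fun w r h => by
  simpa using hx (w ++ [o]) r fun y hy => by simpa using h _ hy

theorem isClosedSet_perpSet (S : Set (List (D ⊕ B) × Formula P D B)) :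
    IsClosedSet I (perpSet I S) :=
  fun _ hx y hy => hx [] _ fun _ hz => hz y hy

/-- The semantic residuation; preservation of joins by the left adjoints follows from it. -/
theorem closure_lowerSet_subset_iff {S T : Set (List (D ⊕ B) × Formula P D B)}
    (hT : IsClosedSet I T) (o : D ⊕ B) : closure I (lowerSet o S) ⊆ T ↔ S ⊆ upperSet o T :=
  ⟨fun h _ hx => h (subset_closure _ ⟨_, hx, rfl⟩),
    fun h => closure_subset hT (Set.image_subset_iff.2 h)⟩

/-- Symmetry of incompatibility makes `perpSet I` a Galois connection with itself, whence the
negation laws other than `neg_contra`. -/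
theorem subset_perpSet_comm {S T : Set (List (D ⊕ B) × Formula P D B)} (h : S ⊆ perpSet I T) :
    T ⊆ perpSet I S :=
  fun x hx _ hy => (h hy x hx).perp_symm

/-- The interpretation of formulas by closed sets of antecedents. -/
def interp (I : D → B → Prop) : Formula P D B → Set (List (D ⊕ B) × Formula P D B)
  | .atom p => {x | CutFree I x.1 x.2 (.form (.atom p))}
  | .bot => closure I ∅
  | .top => Set.univ
  | .and φ ψ => interp I φ ∩ interp I ψ
  | .or φ ψ => closure I (interp I φ ∪ interp I ψ)
  | .neg φ => perpSet I (interp I φ)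
  | .dia d φ => closure I (lowerSet (.inl d) (interp I φ))
  | .bbox d φ => upperSet (.inl d) (interp I φ)
  | .box b φ => upperSet (.inr b) (interp I φ)
  | .bdia b φ => closure I (lowerSet (.inr b) (interp I φ))

theorem isClosedSet_interp (φ : Formula P D B) : IsClosedSet I (interp I φ) := by
  induction φ with
  | atom p => exact isClosedSet_setOf _
  | bot => exact isClosedSet_closure _
  | top => exact Set.subset_univ _
  | and φ ψ h₁ h₂ => exact h₁.inter h₂
  | or φ ψ => exact isClosedSet_closure _
  | neg φ => exact isClosedSet_perpSet _
  | dia d φ => exact isClosedSet_closure _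
  | bbox d φ h => exact h.upperSet _
  | box b φ h => exact h.upperSet _
  | bdia b φ => exact isClosedSet_closure _

theorem closure_lowerSet_mono {S T : Set (List (D ⊕ B) × Formula P D B)} (o : D ⊕ B)
    (h : S ⊆ T) : closure I (lowerSet o S) ⊆ closure I (lowerSet o T) :=
  closure_subset (isClosedSet_closure _) ((Set.image_mono h).trans (subset_closure _))

theorem closure_lowerSet_closure_empty (o : D ⊕ B) :
    closure I (lowerSet o (closure (P := P) I ∅)) ⊆ closure I ∅ :=
  (closure_lowerSet_subset_iff (isClosedSet_closure _) o).2
    (closure_subset ((isClosedSet_closure _).upperSet o) (Set.empty_subset _))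

theorem closure_lowerSet_closure_union (o : D ⊕ B)
    (S T : Set (List (D ⊕ B) × Formula P D B)) :
    closure I (lowerSet o (closure I (S ∪ T))) ⊆
      closure I (closure I (lowerSet o S) ∪ closure I (lowerSet o T)) :=
  (closure_lowerSet_subset_iff (isClosedSet_closure _) o).2
    (closure_subset ((isClosedSet_closure _).upperSet o) (Set.union_subset
      ((closure_lowerSet_subset_iff (isClosedSet_closure _) o).1
        (Set.subset_union_left.trans (subset_closure _)))
      ((closure_lowerSet_subset_iff (isClosedSet_closure _) o).1
        (Set.subset_union_right.trans (subset_closure _)))))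

theorem Derives.interp_subset {φ ψ : Formula P D B} (h : Derives I φ ψ) :
    interp I φ ⊆ interp I ψ := by
  induction h with
  | refl => exact subset_rfl
  | bot_left φ => exact closure_subset (isClosedSet_interp φ) (Set.empty_subset _)
  | top_right => exact Set.subset_univ _
  | or_inl => exact Set.subset_union_left.trans (subset_closure _)
  | or_inr => exact Set.subset_union_right.trans (subset_closure _)
  | and_fst => exact Set.inter_subset_left
  | and_snd => exact Set.inter_subset_right
  | cut _ _ h₁ h₂ => exact h₁.trans h₂
  | and_intro _ _ h₁ h₂ => exact Set.subset_inter h₁ h₂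
  | or_elim _ _ h₁ h₂ => exact closure_subset (isClosedSet_interp _) (Set.union_subset h₁ h₂)
  | dia_bot d => exact closure_lowerSet_closure_empty _
  | dia_or d φ ψ => exact closure_lowerSet_closure_union _ _ _
  | bdia_bot b => exact closure_lowerSet_closure_empty _
  | bdia_or b φ ψ => exact closure_lowerSet_closure_union _ _ _
  | box_top => exact fun _ h => h
  | box_and => exact fun _ h => h
  | bbox_top => exact fun _ h => h
  | bbox_and => exact fun _ h => h
  | neg_bot =>
    exact subset_perpSet_comm (closure_subset (isClosedSet_perpSet _) (Set.empty_subset _))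
  | neg_or φ ψ =>
    exact subset_perpSet_comm (closure_subset (isClosedSet_perpSet _) (Set.union_subset
      (subset_perpSet_comm Set.inter_subset_left) (subset_perpSet_comm Set.inter_subset_right)))
  | dia_mono d _ h => exact closure_lowerSet_mono _ h
  | bdia_mono b _ h => exact closure_lowerSet_mono _ h
  | box_mono b _ h => exact fun _ hx => h hx
  | bbox_mono d _ h => exact fun _ hx => h hx
  | neg_anti _ h => exact fun _ hx y hy => hx y (h hy)
  | dia_adj d _ h => exact (closure_lowerSet_subset_iff (isClosedSet_interp _) _).1 h
  | dia_adj_inv d _ h => exact (closure_lowerSet_subset_iff (isClosedSet_interp _) _).2 h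
  | box_adj b _ h => exact (closure_lowerSet_subset_iff (isClosedSet_interp _) _).2 h
  | box_adj_inv b _ h => exact (closure_lowerSet_subset_iff (isClosedSet_interp _) _).1 h
  -- A member of both sets is incompatible with itself. Membership in `closure I ∅` asks for every
  -- context, hence the prefix and the arbitrary succedent in `contract`.
  | neg_contra φ => exact fun x hx w r _ => (hx.2 x hx.1).contract w r
  | neg_galois _ h => exact subset_perpSet_comm h
  | inter φ hI =>
    exact (closure_lowerSet_subset_iff (isClosedSet_perpSet _) _).2
      fun x hx y hy => ((hx _ hy).perp_symm.inter hI).perp_symm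

theorem mem_closure_lowerSet {S : Set (List (D ⊕ B) × Formula P D B)} {φ : Formula P D B}
    (o : D ⊕ B) (h : ([], φ) ∈ S) : ([], lower o φ) ∈ closure I (lowerSet o S) :=
  fun w r hr => by simpa using (hr _ ⟨_, h, rfl⟩).lower_left

theorem mem_upperSet {S : Set (List (D ⊕ B) × Formula P D B)} (hS : IsClosedSet I S)
    {φ : Formula P D B} (o : D ⊕ B) (h : ([], φ) ∈ S) : ([], upper o φ) ∈ upperSet o S :=
  hS fun w r hr => by simpa using (hr _ h).upper_left o

theorem closure_lowerSet_subset {S : Set (List (D ⊕ B) × Formula P D B)} {φ : Formula P D B}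
    (o : D ⊕ B) (h : S ⊆ {x | CutFree I x.1 x.2 (.form φ)}) :
    closure I (lowerSet o S) ⊆ {x | CutFree I x.1 x.2 (.form (lower o φ))} :=
  (closure_lowerSet_subset_iff (isClosedSet_setOf _) o).2 fun _ hx => (h hx).lower_right o

/-- Every formula belongs to its interpretation, and the members of the interpretation of a formula
entail it in the cut-free calculus. -/
theorem mem_interp_and_subset (φ : Formula P D B) :
    ([], φ) ∈ interp I φ ∧ interp I φ ⊆ {x | CutFree I x.1 x.2 (.form φ)} := by
  induction φ with
  | atom p => exact ⟨.atom p, subset_rfl⟩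
  | bot => exact ⟨fun _ _ _ => .bot_left _ _,
      closure_subset (isClosedSet_setOf _) (Set.empty_subset _)⟩
  | top => exact ⟨trivial, fun _ _ => .top_right _ _⟩
  | and φ ψ h₁ h₂ =>
    exact ⟨⟨isClosedSet_interp φ fun w r hr => (hr _ h₁.1).and_left_fst ψ,
      isClosedSet_interp ψ fun w r hr => (hr _ h₂.1).and_left_snd φ⟩,
      fun _ hx => (h₁.2 hx.1).and_right (h₂.2 hx.2)⟩
  | or φ ψ h₁ h₂ =>
    exact ⟨fun w r hr => (hr _ (.inl h₁.1)).or_left (hr _ (.inr h₂.1)),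
      closure_subset (isClosedSet_setOf _) (Set.union_subset
        (fun _ hx => (h₁.2 hx).or_right_inl ψ) (fun _ hx => (h₂.2 hx).or_right_inr φ))⟩
  -- Negation being antitone, each half uses the other half for `φ`; hence the joint induction.
  | neg φ h => exact ⟨fun _ hy => (h.2 hy).neg_left.perp_symm, fun _ hx => (hx _ h.1).neg_right⟩
  | dia d φ h => exact ⟨mem_closure_lowerSet (.inl d) h.1, closure_lowerSet_subset (.inl d) h.2⟩
  | bbox d φ h => exact ⟨mem_upperSet (isClosedSet_interp φ) (.inl d) h.1,
      fun _ hx => CutFree.upper_right (o := .inl d) (h.2 hx)⟩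
  | box b φ h => exact ⟨mem_upperSet (isClosedSet_interp φ) (.inr b) h.1,
      fun _ hx => CutFree.upper_right (o := .inr b) (h.2 hx)⟩
  | bdia b φ h => exact ⟨mem_closure_lowerSet (.inr b) h.1, closure_lowerSet_subset (.inr b) h.2⟩

theorem Derives.cutFree {φ ψ : Formula P D B} (h : Derives I φ ψ) :
    CutFree I [] φ (.form ψ) :=
  (mem_interp_and_subset ψ).2 (h.interp_subset (mem_interp_and_subset φ).1)

end PhaseSemantics

theorem lyndonInterpolation_derives (I : D → B → Prop) :
    LyndonInterpolation (Derives (P := P) I) := fun _ _ h =>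
  let ⟨γ, hl, hr, hv⟩ := h.cutFree.interpolable
  ⟨γ, hl, hr, hv true, hv false⟩

end FundLogic

/-- Fundamental logic, tense fundamental modal logic, and more generally every expansion of
fundamental logic by modal connectives `◇_d`, `□_b` together with their residuals, with or without
the interaction axioms, have the Lyndon interpolation property. -/
theorem mainTheorem7 (P : Type*) :
    FundLogic.LyndonInterpolation (FundLogic.FundamentalLogic P) ∧
    FundLogic.LyndonInterpolation (FundLogic.TenseFundamentalModalLogic P) ∧
    ∀ (D B : Type*) (I : D → B → Prop),
      FundLogic.LyndonInterpolation (FundLogic.Derives (P := P) I) :=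
  ⟨FundLogic.lyndonInterpolation_derives _, FundLogic.lyndonInterpolation_derives _,
    fun _ _ I => FundLogic.lyndonInterpolation_derives I⟩
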